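/- Let $\mathrm{Homeo}^+(\mathbb R)$ be the group of orientation preserving homeomorphisms of $\mathbb R$, write $\operatorname{supp} f=\{x : f(x)\neq x\}$, and let Thompson's group $F\le \mathrm{Homeo}^+(\mathbb R)$ be generated by $a(x)=x+1$ and the map $b$ with $b(x)=x$ for $x\le 0$, $b(x)=2x$ for $0<x<1$, $b(x)=x+1$ for $x\ge 1$. For $n\ge 2$, a subgroup $G\le \mathrm{Homeo}^+(\mathbb R)$ is an \emph{$n$-chain group} if it is generated by homeomorphisms $f_1,\dots,f_n$ such that (i) the sets $J_i=\operatorname{supp} f_i$ are nonempty open (possibly unbounded) intervals with $J_i\cap J_k=\varnothing$ for $|i-k|>1$, such that for $1\le i<n$ the intersection $J_i\cap J_{i+1}$ is nonempty and is a proper subset both of $J_i$ and of $J_{i+1}$, and $\inf J_i<\inf J_{i+1}$ in $[-\infty,\infty]$; (ii) $f_i(t)\ge t$ for all $t\in\mathbb R$ and all $i$; (iii) $\langle f_i,f_{i+1}\rangle\cong F$ for $1\le i<n$. The \emph{rank} of a chain group $G$ is the least $n$ such that $G$ is isomorphic to an $n$-chain group. For $k\ge2$, the Higman--Thompson group $F_k$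 is $$F_k=\langle g_0,g_1,g_2,\dots \mid g_i^{-1}g_jg_i=g_{j+k-1}\ \text{ for } 0\le i<j\rangle .$$ Proposition. For all integers $2\le k\le n$ there is an $n$-chain group $G_k$ which is isomorphic to the Higman--Thompson group $F_k$ and which satisfies $H_1(G_k;\mathbb Z)\cong\mathbb Z^k$. Moreover, for every $n\ge2$ there is an $n$-chain group of rank $n$. -/

import Mathlib

/-- The group of orientation preserving (that is, strictly increasing) homeomorphisms of the
real line; the product is composition, `(f * g) x = f (g x)`. -/
def HomeoPlus : Subgroup (ℝ ≃ₜ ℝ) where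
  carrier := {f | StrictMono f}
  mul_mem' {f g} hf hg := by
    change StrictMono (fun x => f (g x))
    exact StrictMono.comp hf hg
  one_mem' := strictMono_id
  inv_mem' {f} hf x y hxy := by
    have h : f (f⁻¹ x) < f (f⁻¹ y) := by
      change f (f.symm x) < f (f.symm y)
      simpa using hxy
    exact (StrictMono.lt_iff_lt hf).1 h

namespace HomeoPlus

/-- The value of `f` at `x`. -/
def app (f : HomeoPlus) (x : ℝ) : ℝ := (f : ℝ ≃ₜ ℝ) x

/-- The support `{x | f x ≠ x}` (no closure is taken). -/
def supp (f : HomeoPlus) : Set ℝ := {x | app f x ≠ x}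

end HomeoPlus

/-- The left endpoint of an interval, in the extended real line. -/
noncomputable def leftEndpoint (J : Set ℝ) : EReal := sInf ((fun x : ℝ => (x : EReal)) '' J)

/-- An `n`-chain of intervals `J 0, …, J (n - 1)`: nonempty open subintervals of the line
(possibly unbounded), nonconsecutive ones disjoint, and consecutive ones meeting in a nonempty
proper subinterval of each of the two. -/
structure IsIntervalChain {n : ℕ} (J : Fin n → Set ℝ) : Prop where
  isOpen : ∀ i, IsOpen (J i)
  ordConnected : ∀ i, (J i).OrdConnected
  nonempty : ∀ i, (J i).Nonempty
  disjoint : ∀ i k : Fin n, 1 < |((i : ℕ) : ℤ) - ((k : ℕ) : ℤ)| → J i ∩ J k = ∅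
  overlap : ∀ i k : Fin n, (k : ℕ) = (i : ℕ) + 1 →
    (J i ∩ J k).Nonempty ∧ J i ∩ J k ⊂ J i ∧ J i ∩ J k ⊂ J k

/-- `f 0, …, f (n - 1)` generate a prechain group: `n ≥ 2`, the supports form a chain of intervals
listed by increasing left endpoints, and no point is moved to the left. -/
structure IsPrechain {n : ℕ} (f : Fin n → HomeoPlus) : Prop where
  two_le : 2 ≤ n
  chain : IsIntervalChain fun i => HomeoPlus.supp (f i)
  left_lt : ∀ i k : Fin n, (k : ℕ) = (i : ℕ) + 1 →
    leftEndpoint (HomeoPlus.supp (f i)) < leftEndpoint (HomeoPlus.supp (f k))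
  le_app : ∀ (i : Fin n) (t : ℝ), t ≤ HomeoPlus.app (f i) t

/-- The translation `x ↦ x + 1`. -/
noncomputable def thompsonA : HomeoPlus :=
  ⟨Homeomorph.addRight 1, fun _ _ h => add_lt_add_left h 1⟩

/-- The map that is `x` for `x ≤ 0`, `2 x` for `0 < x < 1` and `x + 1` for `1 ≤ x`. -/
noncomputable def thompsonBFun (x : ℝ) : ℝ :=
  if x ≤ 0 then x else if x < 1 then 2 * x else x + 1

/-- The inverse of `thompsonBFun`. -/
noncomputable def thompsonBInv (x : ℝ) : ℝ :=
  if x ≤ 0 then x else if x < 2 then x / 2 else x - 1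

theorem thompsonBFun_strictMono : StrictMono thompsonBFun := by
  intro x y h
  unfold thompsonBFun
  split_ifs <;> linarith

theorem thompsonBFun_rightInverse : Function.RightInverse thompsonBInv thompsonBFun := by
  intro x
  unfold thompsonBFun thompsonBInv
  split_ifs <;> linarith

/-- `thompsonBFun` as a homeomorphism of the line. -/
noncomputable def thompsonB : HomeoPlus :=
  ⟨(StrictMono.orderIsoOfRightInverse thompsonBFun thompsonBFun_strictMono thompsonBInv
      thompsonBFun_rightInverse).toHomeomorph, thompsonBFun_strictMono⟩

/-- Thompson's group `F`, in its standard copy inside the homeomorphisms of the line. -/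
noncomputable def ThompsonF : Subgroup HomeoPlus := Subgroup.closure {thompsonA, thompsonB}

/-- `G` is an `n`-chain group. -/
def IsChainGroup (n : ℕ) (G : Subgroup HomeoPlus) : Prop :=
  ∃ f : Fin n → HomeoPlus, IsPrechain f ∧ G = Subgroup.closure (Set.range f) ∧
    ∀ i k : Fin n, (k : ℕ) = (i : ℕ) + 1 →
      Nonempty (Subgroup.closure {f i, f k} ≃* ThompsonF)

/-- The chain group `G` has rank `n`: `n` is the least number for which `G` is isomorphic to an
`n`-chain group. -/
def HasChainRank (G : Subgroup HomeoPlus) (n : ℕ) : Prop :=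
  IsLeast {m : ℕ | ∃ H : Subgroup HomeoPlus, IsChainGroup m H ∧ Nonempty (G ≃* H)} n

/-- The relators `g_i⁻¹ g_j g_i (g_{j + n - 1})⁻¹`, for `0 ≤ i < j`. -/
def higmanThompsonRels (n : ℕ) : Set (FreeGroup ℕ) :=
  {r | ∃ i j : ℕ, i < j ∧
    r = (FreeGroup.of i)⁻¹ * FreeGroup.of j * FreeGroup.of i * (FreeGroup.of (j + n - 1))⁻¹}

/-- The Higman–Thompson group `F_n` (for `n ≥ 2`), generated by `g_0, g_1, g_2, …` subject to
`g_i⁻¹ g_j g_i = g_{j + n - 1}` for `i < j`. -/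
abbrev HigmanThompsonF (n : ℕ) : Type := PresentedGroup (higmanThompsonRels n)

/-- First group homology `H₁(G; ℤ)` with trivial integer coefficients. -/
noncomputable abbrev integralH1 (G : Type) [Group G] : ModuleCat ℤ :=
  groupHomology (Rep.trivial ℤ G ℤ) 1

/-! Put d = k - 1 and let r_j be the identity up to j, of slope d + 1 on [j, j + 1], and translation
by d beyond. For i < j, r_i translates [j, ∞) by d, so r_i r_j r_i⁻¹ = r_{j+d}: the inverses of the
r_j satisfy the relations of F_k. They satisfy no others (`nonempty_closure_mulEquiv_higman`): every
element of F_k is a fraction of positive words, and nested supports together with one direction of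
motion let the action separate positive words.

The chain consists of the quotients r_{i+1}⁻¹ r_i for i < n - 1, supported on (i, i + 2), and of
r_{n-1}. It generates r_0, …, r_{n-1}, hence every r_j because n ≥ k. Consecutive pairs generate F
by a dynamical criterion (`nonempty_closure_pair_mulEquiv_higman`), which reuses the recognition of
F_k for k = 2.

Abelianizing the relations only identifies g_j with g_{j+k-1} for j ≥ 1, so H₁ is free of rank k.
For k = n the group maps onto ℤⁿ, so no chain of fewer than n generators can produce it. -/

namespace HomeoPlus

theorem app_mul (f g : HomeoPlus) (x : ℝ) : app (f * g) x = app f (app g x) := rfl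

theorem app_one (x : ℝ) : app 1 x = x := rfl

theorem app_inv_app (f : HomeoPlus) (x : ℝ) : app f⁻¹ (app f x) = x := by
  rw [← app_mul, inv_mul_cancel, app_one]

theorem app_app_inv (f : HomeoPlus) (x : ℝ) : app f (app f⁻¹ x) = x := by
  rw [← app_mul, mul_inv_cancel, app_one]

theorem app_strictMono (f : HomeoPlus) : StrictMono (app f) := f.2

theorem app_mono (f : HomeoPlus) : Monotone (app f) := (app_strictMono f).monotone

theorem ext_app {f g : HomeoPlus} (h : ∀ x, app f x = app g x) : f = g :=
  Subtype.ext (Homeomorph.ext h)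

theorem app_inv_eq_iff (f : HomeoPlus) (x y : ℝ) : app f⁻¹ x = y ↔ x = app f y :=
  ⟨fun h => by rw [← h, app_app_inv], fun h => by rw [h, app_inv_app]⟩

theorem app_inv_le_of_le {f : HomeoPlus} (h : ∀ t, t ≤ app f t) (t : ℝ) : app f⁻¹ t ≤ t := by
  simpa only [app_app_inv] using h (app f⁻¹ t)

end HomeoPlus

open HomeoPlus

/-! ### Recognizing F_k among groups of homeomorphisms -/

section Recognition

variable {k : ℕ} {h : ℕ → HomeoPlus}

/-- The element of the Higman--Thompson group spelled by a positive word. -/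
def higmanWord (k : ℕ) (l : List ℕ) : HigmanThompsonF k :=
  (l.map (PresentedGroup.of (rels := higmanThompsonRels k))).prod

theorem higmanWord_cons (i : ℕ) (l : List ℕ) :
    higmanWord k (i :: l) = PresentedGroup.of i * higmanWord k l := by
  simp [higmanWord]

theorem higmanWord_nil : higmanWord k [] = 1 := rfl

theorem higman_of_mul_of {i j : ℕ} (hij : i < j) :
    (PresentedGroup.of j * PresentedGroup.of i : HigmanThompsonF k) =
      PresentedGroup.of i * PresentedGroup.of (j + k - 1) := by
  have hr : PresentedGroup.mk (higmanThompsonRels k)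
      ((FreeGroup.of i)⁻¹ * FreeGroup.of j * FreeGroup.of i * (FreeGroup.of (j + k - 1))⁻¹) = 1 :=
    PresentedGroup.one_of_mem ⟨i, j, hij, rfl⟩
  simp only [map_mul, map_inv] at hr
  rw [mul_inv_eq_one, mul_assoc, inv_mul_eq_iff_eq_mul] at hr
  exact hr

/-- A letter that is minimal for a positive word either does not occur or can be moved to the
front. -/
theorem higmanWord_pull_front (hk : 1 ≤ k) (i : ℕ) (l : List ℕ) (hl : ∀ a ∈ l, i ≤ a) :
    (∀ a ∈ l, i < a) ∨ ∃ l' : List ℕ, (∀ a ∈ l', i ≤ a) ∧ l'.length < l.length ∧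
      higmanWord k l = higmanWord k (i :: l') := by
  induction l with
  | nil => left; simp
  | cons a l ih =>
    have ha : i ≤ a := hl a (by simp)
    rcases ih fun b hb => hl b (by simp [hb]) with h1 | ⟨l', h1, h2, h3⟩
    · rcases ha.eq_or_lt with rfl | ha
      · exact Or.inr ⟨l, fun b hb => (h1 b hb).le, by simp, rfl⟩
      · left
        simpa using ⟨ha, h1⟩
    · right
      rcases ha.eq_or_lt with rfl | ha
      · exact ⟨i :: l', by simpa using h1, by simpa using h2, by
          rw [higmanWord_cons, h3, ← higmanWord_cons]⟩
      · refine ⟨(a + k - 1) :: l', ?_, by simpa using h2, ?_⟩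
        · simp only [List.mem_cons, forall_eq_or_imp]
          exact ⟨by omega, h1⟩
        · rw [higmanWord_cons, h3, higmanWord_cons, higmanWord_cons, higmanWord_cons,
            ← mul_assoc, higman_of_mul_of ha, mul_assoc]

/-- An inverse generator can be pushed rightwards through a positive word: the relations turn g_i⁻¹
g_a into g_{a+k-1} g_i⁻¹ if i < a, and into g_a g_{i+k-1}⁻¹ if a < i. -/
theorem higman_inv_of_mul_word (i : ℕ) (l : List ℕ) : ∃ l' m : List ℕ,
    (PresentedGroup.of i : HigmanThompsonF k)⁻¹ * higmanWord k l =
      higmanWord k l' * (higmanWord k m)⁻¹ := by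
  induction l generalizing i with
  | nil => exact ⟨[], [i], by simp [higmanWord]⟩
  | cons a l ih =>
    rw [higmanWord_cons]
    rcases lt_trichotomy i a with hia | rfl | hia
    · obtain ⟨l', m, h1⟩ := ih i
      refine ⟨(a + k - 1) :: l', m, ?_⟩
      rw [higmanWord_cons, mul_assoc, ← h1, inv_mul_eq_iff_eq_mul, ← mul_assoc, ← mul_assoc,
        ← higman_of_mul_of hia, mul_inv_cancel_right]
    · exact ⟨l, [], by simp [higmanWord_nil]⟩
    · obtain ⟨l', m, h1⟩ := ih (i + k - 1)
      refine ⟨a :: l', m, ?_⟩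
      rw [higmanWord_cons, mul_assoc, ← h1, inv_mul_eq_iff_eq_mul, ← mul_assoc,
        higman_of_mul_of hia, mul_assoc, mul_inv_cancel_left]

/-- Every element of the Higman--Thompson group is a fraction of two positive words. -/
theorem higman_exists_fraction (x : HigmanThompsonF k) :
    ∃ p q : List ℕ, x = higmanWord k p * (higmanWord k q)⁻¹ := by
  have hx : x ∈ Subgroup.closure
      (Set.range (PresentedGroup.of (rels := higmanThompsonRels k))) := by
    rw [PresentedGroup.closure_range_of]; trivial
  induction hx using Subgroup.closure_induction_left with
  | one => exact ⟨[], [], by simp [higmanWord]⟩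
  | mul_left y hy z _ ih =>
    obtain ⟨i, rfl⟩ := hy
    obtain ⟨p, q, rfl⟩ := ih
    exact ⟨i :: p, q, by rw [higmanWord_cons, mul_assoc]⟩
  | inv_mul_cancel y hy z _ ih =>
    obtain ⟨i, rfl⟩ := hy
    obtain ⟨p, q, rfl⟩ := ih
    obtain ⟨l', m, h1⟩ := higman_inv_of_mul_word i p
    refine ⟨l', q ++ m, ?_⟩
    rw [← mul_assoc, h1]
    simp [higmanWord, mul_assoc]

/-- The homomorphism from the Higman--Thompson group determined by homeomorphisms that satisfy its
defining relations. -/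
def higmanLift (hrel : ∀ i j, i < j → (h i)⁻¹ * h j * h i = h (j + k - 1)) :
    HigmanThompsonF k →* HomeoPlus :=
  PresentedGroup.toGroup (f := h) (by
    rintro r ⟨i, j, hij, rfl⟩
    simp [hrel i j hij])

theorem higmanLift_of (hrel : ∀ i j, i < j → (h i)⁻¹ * h j * h i = h (j + k - 1)) (i : ℕ) :
    higmanLift hrel (PresentedGroup.of i) = h i :=
  PresentedGroup.toGroup.of _

theorem higmanLift_range (hrel : ∀ i j, i < j → (h i)⁻¹ * h j * h i = h (j + k - 1)) :
    (higmanLift hrel).range = Subgroup.closure (Set.range h) := by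
  rw [MonoidHom.range_eq_map, ← PresentedGroup.closure_range_of, MonoidHom.map_closure,
    ← Set.range_comp]
  rfl

/-- Pull the least letter i to the front. If it occurs in both words, it cancels. If it occurs in
only one, take t moved by `h i` and fixed by all later generators: the word without i fixes t, while
the other moves t strictly to the left, since nothing ever moves right. -/
theorem higmanLift_word_injective (hk : 1 ≤ k)
    (hrel : ∀ i j, i < j → (h i)⁻¹ * h j * h i = h (j + k - 1))
    (hle : ∀ i t, app (h i) t ≤ t)
    (hpt : ∀ i, ∃ t, app (h i) t ≠ t ∧ ∀ j, i < j → app (h j) t = t)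
    (p q : List ℕ)
    (hpq : higmanLift hrel (higmanWord k p) = higmanLift hrel (higmanWord k q)) :
    higmanWord k p = higmanWord k q := by
  have hword_le : ∀ (l : List ℕ) (t : ℝ), app (higmanLift hrel (higmanWord k l)) t ≤ t := by
    intro l
    induction l with
    | nil => intro t; simp [higmanWord_nil, app_one]
    | cons a l ih =>
      intro t
      rw [higmanWord_cons, map_mul, app_mul, higmanLift_of]
      exact (hle a _).trans (ih t)
  have hword_fix : ∀ (i : ℕ) (t : ℝ), (∀ j, i < j → app (h j) t = t) → ∀ l : List ℕ,
      (∀ a ∈ l, i < a) → app (higmanLift hrel (higmanWord k l)) t = t := by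
    intro i t ht l
    induction l with
    | nil => intro _; simp [higmanWord_nil, app_one]
    | cons a l ih =>
      intro hl
      rw [higmanWord_cons, map_mul, app_mul, higmanLift_of, ih fun b hb => hl b (by simp [hb]),
        ht a (hl a (by simp))]
  have hne : ∀ (i : ℕ) (l m : List ℕ), (∀ a ∈ m, i < a) →
      higmanLift hrel (higmanWord k (i :: l)) ≠ higmanLift hrel (higmanWord k m) := by
    intro i l m hm heq
    obtain ⟨t, ht, htj⟩ := hpt i
    have h1 := hword_fix i t htj m hm
    rw [← heq, higmanWord_cons, map_mul, app_mul, higmanLift_of] at h1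
    have h2 : app (h i) (app (higmanLift hrel (higmanWord k l)) t) ≤ app (h i) t :=
      app_mono (h i) (hword_le l t)
    exact ht (le_antisymm (hle i t) (h1.symm.le.trans h2))
  induction hN : p.length + q.length using Nat.strong_induction_on generalizing p q with
  | _ N ih =>
    by_cases hex : ∃ i, i ∈ p ++ q
    · classical
      have hmin : ∀ a ∈ p ++ q, Nat.find hex ≤ a := fun a ha => Nat.find_min' hex ha
      have hmem := Nat.find_spec hex
      generalize Nat.find hex = i at hmin hmem
      rcases higmanWord_pull_front hk i p fun a ha => hmin a (by simp [ha]) with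
        hp | ⟨p', -, hp, hpe⟩ <;>
      rcases higmanWord_pull_front hk i q fun a ha => hmin a (by simp [ha]) with
        hq | ⟨q', -, hq, hqe⟩
      · rcases List.mem_append.1 hmem with h1 | h1
        · exact absurd (hp i h1) (lt_irrefl i)
        · exact absurd (hq i h1) (lt_irrefl i)
      · exact absurd (hqe ▸ hpq).symm (hne i q' p hp)
      · exact absurd (hpe ▸ hpq) (hne i p' q hq)
      · rw [hpe, hqe, higmanWord_cons, higmanWord_cons, map_mul, map_mul, mul_right_inj] at hpq
        rw [hpe, hqe, higmanWord_cons, higmanWord_cons,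
          ih _ (by omega) p' q' hpq rfl]
    · have hp : p = [] := List.eq_nil_iff_forall_not_mem.2 fun a ha => hex ⟨a, by simp [ha]⟩
      have hq : q = [] := List.eq_nil_iff_forall_not_mem.2 fun a ha => hex ⟨a, by simp [ha]⟩
      rw [hp, hq]

/-- Homeomorphisms that satisfy the Higman--Thompson relations, never move a point to the right,
and have suitably nested supports generate a copy of the Higman--Thompson group. -/
theorem nonempty_closure_mulEquiv_higman (hk : 1 ≤ k)
    (hrel : ∀ i j, i < j → (h i)⁻¹ * h j * h i = h (j + k - 1))
    (hle : ∀ i t, app (h i) t ≤ t)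
    (hpt : ∀ i, ∃ t, app (h i) t ≠ t ∧ ∀ j, i < j → app (h j) t = t) :
    Nonempty (Subgroup.closure (Set.range h) ≃* HigmanThompsonF k) := by
  have hinj : Function.Injective (higmanLift hrel) := by
    rw [injective_iff_map_eq_one]
    intro x hx
    -- A kernel element p q⁻¹ gives two positive words with the same image.
    obtain ⟨p, q, rfl⟩ := higman_exists_fraction x
    rw [map_mul, map_inv, mul_inv_eq_one] at hx
    rw [mul_inv_eq_one]
    exact higmanLift_word_injective hk hrel hle hpt p q hx
  exact ⟨((MonoidHom.ofInjective hinj).trans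
    (MulEquiv.subgroupCongr (higmanLift_range hrel))).symm⟩

/-- A version of `nonempty_closure_mulEquiv_higman` for the inverses of the generators. -/
theorem nonempty_closure_mulEquiv_higman_of_inv {g : ℕ → HomeoPlus} (hk : 1 ≤ k)
    (hrel : ∀ i j, i < j → g i * g j = g (j + k - 1) * g i)
    (hle : ∀ i t, t ≤ app (g i) t)
    (hpt : ∀ i, ∃ t, app (g i) t ≠ t ∧ ∀ j, i < j → app (g j) t = t) :
    Nonempty (Subgroup.closure (Set.range g) ≃* HigmanThompsonF k) := by
  have hcl : Subgroup.closure (Set.range g) =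
      Subgroup.closure (Set.range fun i => (g i)⁻¹) := by
    rw [← Subgroup.closure_inv (Set.range g), Set.inv_range]
  rw [hcl]
  refine nonempty_closure_mulEquiv_higman hk (fun i j hij => ?_)
    (fun i => app_inv_le_of_le (hle i)) fun i => ?_
  · rw [inv_inv, mul_inv_eq_iff_eq_mul, eq_inv_mul_iff_mul_eq, ← mul_assoc, mul_inv_eq_iff_eq_mul]
    exact (hrel i j hij).symm
  · obtain ⟨t, ht, htj⟩ := hpt i
    refine ⟨t, fun h0 => ht ?_, fun j hj => ?_⟩
    · exact ((app_inv_eq_iff _ _ _).1 h0).symm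
    · exact (app_inv_eq_iff _ _ _).2 (htj j hj).symm

end Recognition

/-! ### Pairs of homeomorphisms generating Thompson's group -/

section Pairs

/-- The conjugates `c ^ m * g * (c ^ m)⁻¹`, preceded by `c`. -/
def conjugateSeq (c g : HomeoPlus) : ℕ → HomeoPlus
  | 0 => c
  | m + 1 => c ^ m * g * (c ^ m)⁻¹

theorem conjugateSeq_add (c g : HomeoPlus) (a b : ℕ) :
    conjugateSeq c g (a + b + 1) = c ^ a * conjugateSeq c g (b + 1) * (c ^ a)⁻¹ := by
  simp only [conjugateSeq, pow_add]
  group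

theorem closure_range_conjugateSeq (c g : HomeoPlus) :
    Subgroup.closure (Set.range (conjugateSeq c g)) = Subgroup.closure {c, g} := by
  apply le_antisymm <;> rw [Subgroup.closure_le]
  · rintro _ ⟨i, rfl⟩
    have hc : c ∈ Subgroup.closure {c, g} := Subgroup.subset_closure (by simp)
    have hg : g ∈ Subgroup.closure {c, g} := Subgroup.subset_closure (by simp)
    cases i with
    | zero => exact hc
    | succ m => exact mul_mem (mul_mem (pow_mem hc m) hg) (inv_mem (pow_mem hc m))
  · rintro x (rfl | rfl)
    · exact Subgroup.subset_closure ⟨0, rfl⟩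
    · exact Subgroup.subset_closure ⟨1, by simp [conjugateSeq]⟩

theorem le_app_pow {c : HomeoPlus} (hc : ∀ t, t ≤ app c t) (m : ℕ) (t : ℝ) :
    t ≤ app (c ^ m) t := by
  induction m with
  | zero => simp [app_one]
  | succ m ih =>
    rw [pow_succ', app_mul]
    exact ih.trans (hc _)

theorem app_pow_le_app_pow {c : HomeoPlus} (hc : ∀ t, t ≤ app c t) {m n : ℕ} (hmn : m ≤ n)
    (t : ℝ) : app (c ^ m) t ≤ app (c ^ n) t := by
  obtain ⟨d, rfl⟩ := Nat.exists_eq_add_of_le' hmn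
  rw [pow_add, app_mul]
  exact le_app_pow hc d _

theorem app_conj_eq_self_iff (c g : HomeoPlus) (t : ℝ) :
    app (c * g * c⁻¹) t = t ↔ app g (app c⁻¹ t) = app c⁻¹ t := by
  rw [app_mul, app_mul, eq_comm (a := app g _), app_inv_eq_iff, eq_comm]

/-- A criterion for two homeomorphisms to generate a copy of Thompson's group. -/
theorem nonempty_closure_pair_mulEquiv_higman {c g : HomeoPlus} {q : ℝ}
    (hc : ∀ t, t ≤ app c t) (hg : ∀ t, t ≤ app g t) (hcq : q < app c q)
    (hfix : ∀ t ≤ q, app g t = t) (heq : ∀ t, app c q ≤ t → app g t = app c t) :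
    Nonempty (Subgroup.closure {c, g} ≃* HigmanThompsonF 2) := by
  have hfixm : ∀ m t, t ≤ app (c ^ m) q → app (conjugateSeq c g (m + 1)) t = t := by
    intro m t ht
    rw [conjugateSeq, app_conj_eq_self_iff]
    apply hfix
    simpa only [app_inv_app] using app_mono (c ^ m)⁻¹ ht
  have hle : ∀ i t, t ≤ app (conjugateSeq c g i) t := by
    rintro (_ | m) t
    · exact hc t
    · have h1 := app_mono (c ^ m) (hg (app (c ^ m)⁻¹ t))
      rwa [app_app_inv] at h1
  have hrel0 : ∀ m, c * conjugateSeq c g (m + 1) = conjugateSeq c g (m + 2) * c := by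
    intro m
    rw [show m + 2 = 1 + m + 1 by ring, conjugateSeq_add, pow_one, inv_mul_cancel_right]
  have hrel1 : ∀ m, g * conjugateSeq c g (m + 2) = conjugateSeq c g (m + 3) * g := by
    intro m
    apply ext_app
    intro t
    rw [app_mul, app_mul]
    rcases le_total t (app c q) with ht | ht
    · have h1 : app c q ≤ app (c ^ (m + 1)) q := by
        simpa using app_pow_le_app_pow hc (show 1 ≤ m + 1 by omega) q
      rw [hfixm (m + 1) t (ht.trans h1), hfixm (m + 2)]
      refine (app_mono g ht).trans ?_
      rw [heq _ le_rfl, ← app_mul, ← pow_two]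
      exact app_pow_le_app_pow hc (by omega) q
    · rw [heq t ht, heq _ (ht.trans (hle _ t)), ← app_mul, ← app_mul, hrel0]
  rw [← closure_range_conjugateSeq]
  refine nonempty_closure_mulEquiv_higman_of_inv one_le_two ?_ hle ?_
  · rintro (_ | i) j hij
    · obtain ⟨m, rfl⟩ := Nat.exists_eq_add_of_lt hij
      rw [zero_add]
      exact hrel0 m
    · obtain ⟨m, rfl⟩ := Nat.exists_eq_add_of_lt hij
      have h1 := conjugateSeq_add c g i 0
      have h2 := conjugateSeq_add c g i (m + 1)
      have h3 := conjugateSeq_add c g i (m + 2)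
      rw [show i + 0 + 1 = i + 1 by ring, show conjugateSeq c g (0 + 1) = g by
        simp [conjugateSeq]] at h1
      rw [show i + 1 + m + 1 + 2 - 1 = i + (m + 2) + 1 by omega,
        show i + 1 + m + 1 = i + (m + 1) + 1 by ring, h1, h2, h3]
      -- The general relation is the one for `g`, conjugated by `c ^ i`.
      have h4 := hrel1 m
      calc _ = c ^ i * (g * conjugateSeq c g (m + 2)) * (c ^ i)⁻¹ := by group
        _ = _ := by rw [h4]; group
  · intro i
    -- The supports recede along the orbit of `q`: all conjugates of index above i fix everything up
    -- to `c ^ i q`.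
    refine ⟨app (c ^ i) q, ?_, ?_⟩
    · cases i with
      | zero => simpa [conjugateSeq, app_one] using hcq.ne'
      | succ m =>
        rw [conjugateSeq, Ne, app_conj_eq_self_iff, pow_succ, app_mul, app_inv_app,
          heq _ le_rfl]
        exact (app_strictMono c hcq).ne'
    · rintro (_ | m) hm
      · omega
      · exact hfixm m _ (app_pow_le_app_pow hc (by omega) q)

theorem nonempty_thompsonF_mulEquiv_higman : Nonempty (ThompsonF ≃* HigmanThompsonF 2) := by
  have ha : ∀ t, app thompsonA t = t + 1 := fun _ => rfl
  have hb : ∀ t, app thompsonB t = if t ≤ 0 then t else if t < 1 then 2 * t else t + 1 :=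
    fun _ => rfl
  refine nonempty_closure_pair_mulEquiv_higman (q := 0) (fun t => ?_) (fun t => ?_) ?_
    (fun t ht => ?_) fun t ht => ?_
  · rw [ha]; linarith
  · rw [hb]; split_ifs <;> linarith
  · rw [ha]; norm_num
  · rw [hb, if_pos ht]
  · rw [ha] at ht ⊢
    rw [hb, if_neg (by linarith), if_neg (by linarith)]

end Pairs

/-! ### Piecewise linear ramps and their relations -/

section Ramps

/-- The function that is `0` for `s ≤ 0`, `s` for `0 ≤ s ≤ 1` and `1` for `s ≥ 1`. -/
noncomputable def unitClamp (s : ℝ) : ℝ := max 0 (min s 1)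

theorem unitClamp_of_nonpos {s : ℝ} (hs : s ≤ 0) : unitClamp s = 0 :=
  max_eq_left ((min_le_left _ _).trans hs)

theorem unitClamp_of_one_le {s : ℝ} (hs : 1 ≤ s) : unitClamp s = 1 := by
  rw [unitClamp, min_eq_right hs, max_eq_right zero_le_one]

theorem unitClamp_of_mem {s : ℝ} (h0 : 0 ≤ s) (h1 : s ≤ 1) : unitClamp s = s := by
  rw [unitClamp, min_eq_left h1, max_eq_right h0]

theorem unitClamp_nonneg (s : ℝ) : 0 ≤ unitClamp s := le_max_left _ _

theorem unitClamp_mono : Monotone unitClamp := fun _ _ h =>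
  max_le_max le_rfl (min_le_min h le_rfl)

theorem unitClamp_continuous : Continuous unitClamp := by
  unfold unitClamp; fun_prop

/-- The piecewise linear map that is the identity up to `x`, has slope `d + 1` on `[x, x + 1]`, and
is the translation by `d` from `x + 1` on. -/
noncomputable def rampFun (d : ℕ) (x t : ℝ) : ℝ := t + d * unitClamp (t - x)

theorem le_rampFun (d : ℕ) (x t : ℝ) : t ≤ rampFun d x t :=
  le_add_of_nonneg_right (mul_nonneg d.cast_nonneg (unitClamp_nonneg _))

theorem rampFun_strictMono (d : ℕ) (x : ℝ) : StrictMono (rampFun d x) := fun s t h =>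
  add_lt_add_of_lt_of_le h
    (mul_le_mul_of_nonneg_left (unitClamp_mono (by linarith)) d.cast_nonneg)

theorem rampFun_of_le {d : ℕ} {x t : ℝ} (h : t ≤ x) : rampFun d x t = t := by
  rw [rampFun, unitClamp_of_nonpos (by linarith), mul_zero, add_zero]

theorem rampFun_of_add_one_le {d : ℕ} {x t : ℝ} (h : x + 1 ≤ t) : rampFun d x t = t + d := by
  rw [rampFun, unitClamp_of_one_le (by linarith), mul_one]

theorem rampFun_surjective (d : ℕ) (x : ℝ) : Function.Surjective (rampFun d x) := by
  have hcont : Continuous (rampFun d x) := by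
    unfold rampFun
    exact continuous_id.add (continuous_const.mul (unitClamp_continuous.comp (by fun_prop)))
  refine hcont.surjective (Filter.tendsto_atTop_mono (le_rampFun d x) Filter.tendsto_id) ?_
  refine Filter.tendsto_id.congr' ?_
  filter_upwards [Filter.eventually_le_atBot x] with t ht
  exact (rampFun_of_le ht).symm

/-- `rampFun` as a homeomorphism of the line. -/
noncomputable def ramp (d : ℕ) (x : ℝ) : HomeoPlus :=
  ⟨(StrictMono.orderIsoOfSurjective _ (rampFun_strictMono d x)
    (rampFun_surjective d x)).toHomeomorph, rampFun_strictMono d x⟩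

theorem app_ramp (d : ℕ) (x t : ℝ) : app (ramp d x) t = rampFun d x t := rfl

/-- On [y, ∞) the left ramp is translation by d, so conjugating `ramp d y` by it just shifts the
break points by d. -/
theorem ramp_mul_ramp {d : ℕ} {x y : ℝ} (h : x + 1 ≤ y) :
    ramp d x * ramp d y = ramp d (y + d) * ramp d x := by
  apply ext_app
  intro t
  simp only [app_mul, app_ramp]
  rcases le_total t y with ht | ht
  · rw [rampFun_of_le ht, rampFun_of_le (x := y + d)]
    rw [← rampFun_of_add_one_le h]
    exact (rampFun_strictMono d x).monotone ht
  · rw [rampFun_of_add_one_le (h.trans ht),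
      rampFun_of_add_one_le ((h.trans ht).trans (le_rampFun d y t)), rampFun, rampFun,
      add_sub_add_right_eq_sub]
    ring

theorem rampFun_ne {d : ℕ} (hd : 1 ≤ d) {x t : ℝ} (h : x < t) : t < rampFun d x t := by
  have h1 : 0 < unitClamp (t - x) := lt_max_of_lt_right (lt_min (by linarith) one_pos)
  have h2 : (0 : ℝ) < d := by exact_mod_cast hd
  exact lt_add_of_pos_right _ (mul_pos h2 h1)

theorem nonempty_closure_ramp_mulEquiv_higman {k : ℕ} (hk : 2 ≤ k) :
    Nonempty (Subgroup.closure (Set.range fun i : ℕ => ramp (k - 1) i) ≃* HigmanThompsonF k) := by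
  refine nonempty_closure_mulEquiv_higman_of_inv (by omega) (fun i j hij => ?_)
    (fun i t => le_rampFun _ _ _) fun i => ⟨i + 1, ?_, fun j hj => ?_⟩
  · rw [Nat.add_sub_assoc (by omega), Nat.cast_add]
    exact ramp_mul_ramp (by exact_mod_cast hij)
  · exact (rampFun_ne (by omega) (by linarith)).ne'
  · exact rampFun_of_le (by exact_mod_cast hj)

end Ramps

/-! ### The chain of intervals and its generators -/

section Chain

/-- The difference of two consecutive ramps. -/
noncomputable def bump (d : ℕ) (x : ℝ) : HomeoPlus := (ramp d (x + 1))⁻¹ * ramp d x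

theorem ramp_succ_mul_bump (d : ℕ) (x : ℝ) : ramp d (x + 1) * bump d x = ramp d x :=
  mul_inv_cancel_left _ _

theorem le_app_bump (d : ℕ) (x t : ℝ) : t ≤ app (bump d x) t := by
  rw [← (app_strictMono (ramp d (x + 1))).le_iff_le, ← app_mul, ramp_succ_mul_bump]
  exact add_le_add_right
    (mul_le_mul_of_nonneg_left (unitClamp_mono (by linarith)) d.cast_nonneg) t

theorem app_bump_eq_self_iff {d : ℕ} (hd : 1 ≤ d) (x t : ℝ) :
    app (bump d x) t = t ↔ t ≤ x ∨ x + 2 ≤ t := by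
  have h2 : (d : ℝ) ≠ 0 := by exact_mod_cast (by omega : d ≠ 0)
  rw [bump, app_mul, app_inv_eq_iff, app_ramp, app_ramp, rampFun, rampFun, add_right_inj,
    mul_right_inj' h2]
  constructor
  · intro h
    by_contra! hcon
    have h3 : 0 < t - x := by linarith
    rcases le_total t (x + 1) with ht | ht
    · rw [unitClamp_of_mem h3.le (by linarith), unitClamp_of_nonpos (by linarith)] at h
      linarith
    · rw [unitClamp_of_one_le (by linarith), unitClamp_of_mem (by linarith) (by linarith)] at h
      linarith
  · rintro (h | h)
    · rw [unitClamp_of_nonpos (by linarith), unitClamp_of_nonpos (by linarith)]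
    · rw [unitClamp_of_one_le (by linarith), unitClamp_of_one_le (by linarith)]

theorem supp_bump {d : ℕ} (hd : 1 ≤ d) (x : ℝ) : supp (bump d x) = Set.Ioo x (x + 2) := by
  ext t
  rw [supp, Set.mem_ofPred_eq, Ne, app_bump_eq_self_iff hd, Set.mem_Ioo]
  push Not
  rfl

theorem supp_ramp {d : ℕ} (hd : 1 ≤ d) (x : ℝ) : supp (ramp d x) = Set.Ioi x := by
  ext t
  refine ⟨fun h => ?_, fun h => (rampFun_ne hd h).ne'⟩
  by_contra h1
  exact h (rampFun_of_le (not_lt.1 h1))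

/-- The generators of an `n`-chain group that is a copy of a Higman--Thompson group. -/
noncomputable def rampChain (d n : ℕ) (i : Fin n) : HomeoPlus :=
  if (i : ℕ) + 1 < n then bump d (i : ℕ) else ramp d (i : ℕ)

theorem mem_supp_rampChain {d : ℕ} (hd : 1 ≤ d) {n : ℕ} (i : Fin n) (t : ℝ) :
    t ∈ supp (rampChain d n i) ↔ (i : ℝ) < t ∧ ((i : ℕ) + 1 < n → t < (i : ℝ) + 2) := by
  unfold rampChain
  split_ifs with h
  · simp [supp_bump hd, h]
  · simp [supp_ramp hd, h]

theorem leftEndpoint_of_Ioo_subset {J : Set ℝ} {x y : ℝ} (hxy : x < y) (h1 : Set.Ioo x y ⊆ J)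
    (h2 : J ⊆ Set.Ioi x) : leftEndpoint J = x := by
  apply le_antisymm
  · refine le_of_forall_gt_imp_ge_of_dense fun z hz => ?_
    obtain ⟨w, hxw, hwz⟩ := EReal.lt_iff_exists_real_btwn.1 hz
    obtain ⟨v, hv1, hv2⟩ := exists_between (lt_min hxy (EReal.coe_lt_coe_iff.1 hxw))
    refine (sInf_le (Set.mem_image_of_mem _ (h1 ⟨hv1, hv2.trans_le (min_le_left _ _)⟩))).trans ?_
    exact (EReal.coe_le_coe_iff.2 (hv2.le.trans (min_le_right _ _))).trans hwz.le
  · refine le_sInf ?_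
    rintro _ ⟨t, ht, rfl⟩
    exact EReal.coe_le_coe_iff.2 (h2 ht).le

theorem supp_rampChain_inter_eq_empty {d : ℕ} (hd : 1 ≤ d) {n : ℕ} {i k : Fin n}
    (hik : (i : ℕ) + 2 ≤ k) : supp (rampChain d n i) ∩ supp (rampChain d n k) = ∅ := by
  rw [Set.eq_empty_iff_forall_notMem]
  rintro t ⟨h1, h2⟩
  rw [mem_supp_rampChain hd] at h1 h2
  have h3 := h1.2 (by omega)
  have h4 : (i : ℝ) + 2 ≤ k := by exact_mod_cast hik
  linarith [h2.1]

theorem isPrechain_rampChain {d n : ℕ} (hd : 1 ≤ d) (hn : 2 ≤ n) : IsPrechain (rampChain d n) where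
  two_le := hn
  chain := by
    refine ⟨fun i => ?_, fun i => ?_, fun i => ⟨(i : ℝ) + 1, ?_⟩, fun i k hik => ?_,
      fun i k hik => ?_⟩
    · unfold rampChain
      split_ifs
      · rw [supp_bump hd]; exact isOpen_Ioo
      · rw [supp_ramp hd]; exact isOpen_Ioi
    · unfold rampChain
      split_ifs
      · rw [supp_bump hd]; exact Set.ordConnected_Ioo
      · rw [supp_ramp hd]; exact Set.ordConnected_Ioi
    · rw [mem_supp_rampChain hd]
      constructor
      · linarith
      · intro; linarith
    · rcases lt_abs.1 hik with h | h
      · rw [Set.inter_comm]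
        exact supp_rampChain_inter_eq_empty hd (by omega)
      · exact supp_rampChain_inter_eq_empty hd (by omega)
    · have hk : (k : ℝ) = i + 1 := by exact_mod_cast hik
      have hi : (i : ℕ) + 1 < n := by omega
      refine ⟨⟨(i : ℝ) + 3 / 2, ?_, ?_⟩, ⟨Set.inter_subset_left, fun h => ?_⟩,
        ⟨Set.inter_subset_right, fun h => ?_⟩⟩
      · rw [mem_supp_rampChain hd]
        exact ⟨by linarith, fun _ => by linarith⟩
      · rw [mem_supp_rampChain hd, hk]
        exact ⟨by linarith, fun _ => by linarith⟩
      -- The left end of the second interval lies only in the first; below, the right end i + 2 of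
      -- the first lies only in the second.
      · have h1 := (@h ((i : ℝ) + 1)
          ((mem_supp_rampChain hd _ _).2 ⟨by linarith, fun _ => by linarith⟩)).2
        rw [mem_supp_rampChain hd, hk] at h1
        linarith [h1.1]
      · have h1 := (@h ((i : ℝ) + 2)
          ((mem_supp_rampChain hd _ _).2 ⟨by linarith, fun _ => by linarith⟩)).1
        rw [mem_supp_rampChain hd] at h1
        linarith [h1.2 hi]
  left_lt := by
    intro i k hik
    have h : ∀ i : Fin n, leftEndpoint (supp (rampChain d n i)) = ((i : ℕ) : ℝ) := by
      intro i
      refine leftEndpoint_of_Ioo_subset (y := (i : ℝ) + 2) (by linarith) (fun t ht => ?_)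
        fun t ht => ((mem_supp_rampChain hd _ _).1 ht).1
      exact (mem_supp_rampChain hd _ _).2 ⟨ht.1, fun _ => ht.2⟩
    rw [h, h, EReal.coe_lt_coe_iff, Nat.cast_lt]
    omega
  le_app i t := by
    unfold rampChain
    split_ifs
    · exact le_app_bump _ _ _
    · exact le_rampFun _ _ _

/-- Multiplying the quotients telescopes down from the last ramp to the ramps of index below n;
conjugation by the ramp at 0 yields the rest. -/
theorem closure_range_rampChain {k n : ℕ} (hk : 2 ≤ k) (hkn : k ≤ n) :
    Subgroup.closure (Set.range (rampChain (k - 1) n)) =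
      Subgroup.closure (Set.range fun i : ℕ => ramp (k - 1) i) := by
  apply le_antisymm <;> rw [Subgroup.closure_le]
  · have hr : ∀ i : ℕ, ramp (k - 1) i ∈
        Subgroup.closure (Set.range fun i : ℕ => ramp (k - 1) i) :=
      fun i => Subgroup.subset_closure ⟨i, rfl⟩
    rintro _ ⟨i, rfl⟩
    rw [rampChain]
    split_ifs
    · exact mul_mem (inv_mem (by exact_mod_cast hr (i + 1))) (hr i)
    · exact hr i
  · have hr : ∀ i : Fin n, rampChain (k - 1) n i ∈
        Subgroup.closure (Set.range (rampChain (k - 1) n)) :=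
      fun i => Subgroup.subset_closure ⟨i, rfl⟩
    have hlow : ∀ m i : ℕ, i + m + 1 = n → ramp (k - 1) i ∈
        Subgroup.closure (Set.range (rampChain (k - 1) n)) := by
      intro m
      induction m with
      | zero =>
        intro i hi
        have h := hr ⟨i, by omega⟩
        rwa [rampChain, if_neg (by simp; omega)] at h
      | succ m ih =>
        intro i hi
        have h := hr ⟨i, by omega⟩
        rw [rampChain, if_pos (by simp; omega)] at h
        rw [← ramp_succ_mul_bump]
        exact mul_mem (by exact_mod_cast ih (i + 1) (by omega)) h
    have hall : ∀ j : ℕ, ramp (k - 1) j ∈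
        Subgroup.closure (Set.range (rampChain (k - 1) n)) := by
      intro j
      induction j using Nat.strong_induction_on with
      | _ j ih =>
        rcases lt_or_ge j n with hj | hj
        · exact hlow (n - 1 - j) j (by omega)
        · obtain ⟨m, rfl⟩ := Nat.exists_eq_add_of_le' (show k - 1 ≤ j by omega)
          -- Here k ≤ n is used: j ≥ k makes m = j - (k - 1) at least 1, as needed to conjugate by
          -- the ramp at 0.
          have h1 : ((0 : ℕ) : ℝ) + 1 ≤ (m : ℝ) := by exact_mod_cast (by omega : 0 + 1 ≤ m)
          rw [Nat.cast_add, ← mul_inv_eq_of_eq_mul (ramp_mul_ramp (d := k - 1) h1)]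
          exact mul_mem (mul_mem (ih 0 (by omega)) (ih m (by omega))) (inv_mem (ih 0 (by omega)))
    rintro _ ⟨j, rfl⟩
    exact hall j

theorem closure_pair_mul_left {G : Type*} [Group G] (f g : G) :
    Subgroup.closure {g * f, g} = Subgroup.closure {f, g} := by
  apply le_antisymm <;> rw [Subgroup.closure_le]
  · have hf : f ∈ Subgroup.closure {f, g} := Subgroup.subset_closure (by simp)
    have hg : g ∈ Subgroup.closure {f, g} := Subgroup.subset_closure (by simp)
    rintro x (rfl | rfl)
    · exact mul_mem hg hf
    · exact hg
  · have hf : g * f ∈ Subgroup.closure {g * f, g} := Subgroup.subset_closure (by simp)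
    have hg : g ∈ Subgroup.closure {g * f, g} := Subgroup.subset_closure (by simp)
    rintro x (rfl | rfl)
    · simpa using mul_mem (inv_mem hg) hf
    · exact hg

/-- The criterion applies to c = g * `bump d x` and g with q = x + 1: by `hle`, c carries q past the
support of the bump, and from there on c equals g. -/
theorem nonempty_closure_bump_pair_mulEquiv_higman {d : ℕ} (hd : 1 ≤ d) {x : ℝ} {g : HomeoPlus}
    (hg : ∀ t, t ≤ app g t) (hfix : ∀ t ≤ x + 1, app g t = t)
    (hle : x + 2 ≤ app g (app (bump d x) (x + 1))) :
    Nonempty (Subgroup.closure {bump d x, g} ≃* HigmanThompsonF 2) := by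
  rw [← closure_pair_mul_left]
  refine nonempty_closure_pair_mulEquiv_higman (q := x + 1)
    (fun t => (le_app_bump d x t).trans (hg _)) hg ?_ hfix fun t ht => ?_
  · rw [app_mul]; linarith
  · rw [app_mul] at ht ⊢
    rw [(app_bump_eq_self_iff hd x t).2 (Or.inr (hle.trans ht))]

theorem nonempty_closure_rampChain_pair_mulEquiv_higman {d n : ℕ} (hd : 1 ≤ d) (i j : Fin n)
    (hij : (j : ℕ) = i + 1) :
    Nonempty (Subgroup.closure {rampChain d n i, rampChain d n j} ≃* HigmanThompsonF 2) := by
  have hj : ((j : ℕ) : ℝ) = (i : ℕ) + 1 := by exact_mod_cast hij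
  have hle : (i : ℝ) + 2 ≤ app (ramp d (i : ℕ)) ((i : ℕ) + 1) := by
    have h : (1 : ℝ) ≤ d := by exact_mod_cast hd
    rw [app_ramp, rampFun_of_add_one_le le_rfl]
    linarith
  rw [show rampChain d n i = bump d (i : ℕ) from if_pos (by omega)]
  apply nonempty_closure_bump_pair_mulEquiv_higman hd <;> unfold rampChain <;> split_ifs <;> rw [hj]
  · exact le_app_bump _ _
  · exact le_rampFun _ _
  · exact fun t ht => (app_bump_eq_self_iff hd _ t).2 (Or.inl ht)
  · exact fun t ht => rampFun_of_le ht
  -- The product of two consecutive bumps telescopes to a quotient of ramps, and the ramp at i + 2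
  -- fixes i + 2.
  · rw [← app_mul, bump, mul_assoc, ramp_succ_mul_bump, app_mul,
      ← (app_strictMono (ramp d (i + 1 + 1))).le_iff_le, app_app_inv,
      app_ramp d (i + 1 + 1), rampFun_of_le (by linarith)]
    exact hle
  · rw [← app_mul, ramp_succ_mul_bump]
    exact hle

theorem isChainGroup_closure_rampChain {d n : ℕ} (hd : 1 ≤ d) (hn : 2 ≤ n) :
    IsChainGroup n (Subgroup.closure (Set.range (rampChain d n))) := by
  refine ⟨rampChain d n, isPrechain_rampChain hd hn, rfl, fun i j hij => ?_⟩
  obtain ⟨e⟩ := nonempty_closure_rampChain_pair_mulEquiv_higman hd i j hij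
  obtain ⟨e'⟩ := nonempty_thompsonF_mulEquiv_higman
  exact ⟨e.trans e'.symm⟩

end Chain

/-! ### First homology and the number of generators -/

section Homology

/-- The first integral homology is the abelianization. -/
noncomputable def integralH1AddEquiv (G : Type) [Group G] :
    integralH1 G ≃+ Additive (Abelianization G) :=
  (groupHomology.H1AddEquivOfIsTrivial (Rep.trivial ℤ G ℤ)).trans
    (TensorProduct.rid ℤ (Additive (Abelianization G))).toAddEquiv

/-- The index modulo the relations `j ∼ j + (d + 1)` for `j ≥ 1`. -/
def higmanIndex (d : ℕ) : ℕ → Fin (d + 2)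
  | 0 => 0
  | j + 1 => Fin.succ (Fin.ofNat (d + 1) j)

theorem higmanIndex_val {d : ℕ} (i : Fin (d + 2)) : higmanIndex d i = i := by
  induction i using Fin.cases with
  | zero => rfl
  | succ i => simp [higmanIndex]

theorem higmanIndex_add {d j : ℕ} (hj : 0 < j) :
    higmanIndex d (j + (d + 2) - 1) = higmanIndex d j := by
  obtain ⟨j, rfl⟩ := Nat.exists_eq_succ_of_ne_zero hj.ne'
  rw [show j.succ + (d + 2) - 1 = j + (d + 1) + 1 by omega]
  simp [higmanIndex, Fin.ext_iff]

/-- Counting generators with exponents. -/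
def higmanCount (d : ℕ) : HigmanThompsonF (d + 2) →* Multiplicative (Fin (d + 2) → ℤ) :=
  PresentedGroup.toGroup (f := fun j => Multiplicative.ofAdd (Pi.single (higmanIndex d j) 1)) (by
    rintro r ⟨i, j, hij, rfl⟩
    simp only [map_mul, map_inv, FreeGroup.lift_apply_of,
      higmanIndex_add (Nat.zero_lt_of_lt hij), inv_mul_cancel_comm, mul_inv_cancel])

theorem higmanCount_of (d j : ℕ) : higmanCount d (PresentedGroup.of j) =
    Multiplicative.ofAdd (Pi.single (higmanIndex d j) 1) :=
  PresentedGroup.toGroup.of _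

theorem abelianization_of_higman_add {k j : ℕ} (hj : 0 < j) :
    Abelianization.of (PresentedGroup.of (j + k - 1) : HigmanThompsonF k) =
      Abelianization.of (PresentedGroup.of j) := by
  have h := congrArg Abelianization.of (higman_of_mul_of (k := k) hj)
  rw [map_mul, map_mul, mul_comm] at h
  exact (mul_left_cancel h).symm

theorem abelianization_of_higmanIndex (d j : ℕ) :
    Abelianization.of (PresentedGroup.of (higmanIndex d j : ℕ) : HigmanThompsonF (d + 2)) =
      Abelianization.of (PresentedGroup.of j) := by
  induction j using Nat.strong_induction_on with
  | _ j ih =>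
    rcases lt_or_ge j (d + 2) with h | h
    · rw [show higmanIndex d j = ⟨j, h⟩ from higmanIndex_val ⟨j, h⟩]
    · obtain ⟨m, rfl⟩ := Nat.exists_eq_add_of_le' h
      have h1 : m + (d + 2) = (m + 1) + (d + 2) - 1 := by omega
      rw [h1, higmanIndex_add m.succ_pos, abelianization_of_higman_add m.succ_pos]
      exact ih (m + 1) (by omega)

/-- The class of g_0 stays alone and those of the g_j with j ≥ 1 depend on j modulo k - 1, giving k
classes. Counting letters by class shows that they are independent. -/
theorem nonempty_abelianization_higman {k : ℕ} (hk : 2 ≤ k) :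
    Nonempty (Additive (Abelianization (HigmanThompsonF k)) ≃+ (Fin k → ℤ)) := by
  obtain ⟨d, rfl⟩ := Nat.exists_eq_add_of_le' hk
  let e : Fin (d + 2) → Additive (Abelianization (HigmanThompsonF (d + 2))) := fun i =>
    Additive.ofMul (Abelianization.of (PresentedGroup.of (i : ℕ)))
  let φ : Additive (Abelianization (HigmanThompsonF (d + 2))) →+ (Fin (d + 2) → ℤ) :=
    MonoidHom.toAdditiveLeft (Abelianization.lift (higmanCount d))
  let ψ : (Fin (d + 2) → ℤ) →+ Additive (Abelianization (HigmanThompsonF (d + 2))) :=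
    (Fintype.linearCombination ℤ e).toAddMonoidHom
  have hφ : ∀ j : ℕ, φ (Additive.ofMul (Abelianization.of (PresentedGroup.of j))) =
      Pi.single (higmanIndex d j) 1 := fun j =>
    congrArg Multiplicative.toAdd (higmanCount_of d j)
  have hψ : ∀ i, ψ (Pi.single i 1) = e i := fun i => by
    simp [ψ, Fintype.linearCombination_apply_single]
  refine ⟨AddMonoidHom.toAddEquiv φ ψ ?_ ?_⟩
  · apply MonoidHom.toAdditive.symm.injective
    ext j
    change Additive.toMul (ψ (φ (Additive.ofMul (Abelianization.of (PresentedGroup.of j))))) = _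
    rw [hφ, hψ]
    exact abelianization_of_higmanIndex d j
  · ext i : 2
    change φ (ψ (Pi.single i 1)) = Pi.single i 1
    rw [hψ, hφ, higmanIndex_val]

theorem nonempty_integralH1_addEquiv {G : Type} [Group G] {k : ℕ} (hk : 2 ≤ k)
    (e : G ≃* HigmanThompsonF k) : Nonempty (integralH1 G ≃+ (Fin k → ℤ)) := by
  obtain ⟨f⟩ := nonempty_abelianization_higman hk
  exact ⟨(integralH1AddEquiv G).trans ((MulEquiv.toAdditive e.abelianizationCongr).trans f)⟩

/-- A group with abelianization of rank `n` is not generated by fewer than `n` elements. -/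
theorem le_of_closure_range_eq_top {G : Type*} [Group G] {m n : ℕ} {f : Fin m → G}
    (hf : Subgroup.closure (Set.range f) = ⊤) (φ : G →* Multiplicative (Fin n → ℤ))
    (hφ : Function.Surjective φ) : n ≤ m := by
  let b : Fin m → (Fin n → ℤ) := fun i => Multiplicative.toAdd (φ (f i))
  have hb : Submodule.span ℤ (Set.range b) = ⊤ := by
    have key : ∀ g : G, Multiplicative.toAdd (φ g) ∈ Submodule.span ℤ (Set.range b) := by
      intro g
      have hg : g ∈ Subgroup.closure (Set.range f) := hf ▸ Subgroup.mem_top g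
      induction hg using Subgroup.closure_induction with
      | mem x hx =>
        obtain ⟨i, rfl⟩ := hx
        exact Submodule.subset_span ⟨i, rfl⟩
      | one => simp
      | mul x y _ _ hx hy => rw [map_mul, toAdd_mul]; exact add_mem hx hy
      | inv x _ hx => rw [map_inv, toAdd_inv]; exact neg_mem hx
    rw [eq_top_iff]
    intro v _
    obtain ⟨g, hg⟩ := hφ (Multiplicative.ofAdd v)
    simpa [hg] using key g
  have h := finrank_range_le_card (R := ℤ) b
  rw [Set.finrank, hb, finrank_top, Module.finrank_fin_fun, Fintype.card_fin] at h
  exact h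

end Homology

/-! ### Chain groups of prescribed rank -/

section Main

theorem IsChainGroup.le_of_surjective {m n : ℕ} {H : Subgroup HomeoPlus} (hH : IsChainGroup m H)
    (φ : H →* Multiplicative (Fin n → ℤ)) (hφ : Function.Surjective φ) : n ≤ m := by
  obtain ⟨f, -, rfl, -⟩ := hH
  let f' : Fin m → Subgroup.closure (Set.range f) :=
    fun i => ⟨f i, Subgroup.subset_closure ⟨i, rfl⟩⟩
  refine le_of_closure_range_eq_top (f := f') ?_ φ hφ
  rw [← Subgroup.closure_closure_coe_preimage (k := Set.range f)]
  congr 1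
  ext x
  exact exists_congr fun i => Subtype.ext_iff

theorem exists_isChainGroup_mulEquiv_higman {k n : ℕ} (hk : 2 ≤ k) (hkn : k ≤ n) :
    ∃ G : Subgroup HomeoPlus, IsChainGroup n G ∧ Nonempty (G ≃* HigmanThompsonF k) :=
  ⟨_, isChainGroup_closure_rampChain (d := k - 1) (by omega) (hk.trans hkn), by
    rw [closure_range_rampChain hk hkn]
    exact nonempty_closure_ramp_mulEquiv_higman hk⟩

/-- Any isomorphic m-chain group has m generators and inherits the surjection onto ℤⁿ, which forces
n ≤ m. -/
theorem hasChainRank_of_mulEquiv_higman {n : ℕ} (hn : 2 ≤ n) {G : Subgroup HomeoPlus}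
    (hG : IsChainGroup n G) (e : G ≃* HigmanThompsonF n) : HasChainRank G n := by
  refine ⟨⟨G, hG, ⟨MulEquiv.refl G⟩⟩, ?_⟩
  rintro m ⟨H, hH, ⟨e'⟩⟩
  obtain ⟨a⟩ := nonempty_abelianization_higman hn
  let φ : H →* Multiplicative (Fin n → ℤ) :=
    ((AddEquiv.toMultiplicativeRight a).toMonoidHom.comp Abelianization.of).comp
      (e'.symm.trans e).toMonoidHom
  exact hH.le_of_surjective φ (((AddEquiv.toMultiplicativeRight a).surjective.comp
    (QuotientGroup.mk_surjective)).comp (e'.symm.trans e).surjective)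

end Main

theorem mainTheorem10 :
    (∀ k n : ℕ, 2 ≤ k → k ≤ n →
      ∃ G : Subgroup HomeoPlus, IsChainGroup n G ∧
        Nonempty (G ≃* HigmanThompsonF k) ∧
        Nonempty (integralH1 G ≃+ (Fin k → ℤ))) ∧
    (∀ n : ℕ, 2 ≤ n →
      ∃ G : Subgroup HomeoPlus, IsChainGroup n G ∧ HasChainRank G n) := by
  refine ⟨fun k n hk hkn => ?_, fun n hn => ?_⟩
  · obtain ⟨G, hG, ⟨e⟩⟩ := exists_isChainGroup_mulEquiv_higman hk hkn
    exact ⟨G, hG, ⟨e⟩, nonempty_integralH1_addEquiv hk e⟩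
  · obtain ⟨G, hG, ⟨e⟩⟩ := exists_isChainGroup_mulEquiv_higman hn le_rfl
    exact ⟨G, hG, hasChainRank_of_mulEquiv_higman hn hG e⟩
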